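/- All graphs are finite, undirected and simple. For a graph $G$ and a positive integer $k$, let $h(G,k)$ be the minimum number of edges whose deletion from $G$ leaves a $k$-colorable graph. For a graph $H$ let $h(n,k,H)$ be the maximum of $h(G,k)$ over all $n$-vertex graphs $G$ that do not contain $H$ as a (not necessarily induced) subgraph, and for a family $\mathcal{H}$ of graphs let $h(n,k,\mathcal{H})$ be the maximum of $h(G,k)$ over all $n$-vertex graphs $G$ that contain no member of $\mathcal{H}$ as a subgraph (a maximum over no graphs is $0$). A homomorphism $H\to H'$ is a map $V(H)\to V(H')$ that sends edges of $H$ to edges of $H'$. Fix a positive integer $k$. (1) Let $H$ be a fixed graph that has a subgraph $H'$ for which there is a homomorphism from $H$ to $H'$. Then for all $n$ $$h(n,k,H')\le h(n,k,H)\le h(n,k,H')+o(n^2)\qquad (n\to\infty).$$ (2) More generally, let $\mathcal{H}$ and $\mathcal{H}'$ be fixed finite families of graphs such that for each $H'\in\mathcal{H}'$ there is some $H\in\mathcal{H}$ that has a homomorphism to $H'$. Then $$h(n,k,\mathcal{H})\le h(n,k,\mathcal{H}')+o(n^2)\qquad (n\to\infty).$$ In both parts the $o(n^2)$ term may depend on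 $k$ and on the fixed graphs or families. -/

import Mathlib

open scoped Asymptotics

namespace SimpleGraph

/-- `h(G, k)`: the least number of edges whose deletion from `G` leaves a `k`-colorable graph.
For `k ≥ 1` and finite `G` such a set of edges exists, so the infimum is an attained minimum. -/
noncomputable def colorDeletion {V : Type*} (G : SimpleGraph V) (k : ℕ) : ℕ :=
  sInf {m : ℕ | ∃ s : Finset (Sym2 V),
    (s : Set (Sym2 V)) ⊆ G.edgeSet ∧ s.card = m ∧ (G.deleteEdges (s : Set (Sym2 V))).Colorable k}

/-- `G` is free of a family of graphs: it contains no member of the family as a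
(not necessarily induced) subgraph. -/
def FamilyFree {ι : Type*} {W : ι → Type*} (F : ∀ i, SimpleGraph (W i))
    {V : Type*} (G : SimpleGraph V) : Prop :=
  ∀ i, (F i).Free G

open scoped Classical in
/-- `h(n, k, H)`: the maximum of `h(G, k)` over all `H`-free graphs `G` on `n` vertices
(`0` if there is no such graph). -/
noncomputable def maxColorDeletion (n k : ℕ) {W : Type*} (H : SimpleGraph W) : ℕ :=
  (Finset.univ.filter fun G : SimpleGraph (Fin n) => H.Free G).sup fun G => G.colorDeletion k

open scoped Classical in
/-- `h(n, k, F)` for a family `F` of graphs: the maximum of `h(G, k)` over all graphs `G` on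
`n` vertices that contain no member of `F` (`0` if there is no such graph). -/
noncomputable def maxColorDeletionFamily (n k : ℕ) {ι : Type*} {W : ι → Type*}
    (F : ∀ i, SimpleGraph (W i)) : ℕ :=
  (Finset.univ.filter fun G : SimpleGraph (Fin n) => FamilyFree F G).sup
    fun G => G.colorDeletion k

end SimpleGraph

/-!
Both parts reduce to a removal statement for homomorphisms: for every `ε > 0` and `m`, each large
graph `G` on `n` vertices has a subgraph `G'` missing at most `ε n²` of its edges, such that any
graph on at most `m` vertices that maps homomorphically to `G'` is already contained in `G`
(`exists_le_forall_hom_isContained`).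

The subgraph `G'` comes from Szemerédi's regularity lemma: keep the edges between distinct parts
that form a regular pair of density bounded below. A homomorphism `H →g G'` sends the vertices of
`H` to parts of the partition, adjacent vertices going to dense regular pairs, and a greedy choice
of vertices inside the parts turns it into a copy of `H` in `G`
(`exists_greedy_embedding`). Here the parts may coincide for nonadjacent vertices of `H`, which is
harmless because they have many vertices.

If `G` contains no member of `F` and every `F' j` admits a homomorphism from some `F i`, then `G'`
contains no `F' j`: composing would give a homomorphism `F i →g G'`, hence a copy of `F i` in `G`.
Deleting the edges of `G` outside `G'` first shows `h(G, k) ≤ h(G', k) + ε n²`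
(`colorDeletion_le_add`). Part (1) is the case of one-member families, together with the remark that
an `H'`-free graph is `H`-free when `H'` is a subgraph of `H`.
-/

open Finset Filter

universe u

namespace SimpleGraph

/-! ### Greedy embedding into dense regular pairs -/

/-- If, for adjacent `v, w`, only few vertices of `A v` have few neighbours in any large subset
of `A w`, then the vertices in `S` can be embedded one at a time. The set `C w` holds the remaining
candidates for the image of `w`; each step shrinks it by a factor of at most `d / 2`. -/
lemma exists_greedy_embedding {W α : Type*} [Nonempty α] (H : SimpleGraph W)
    (G : SimpleGraph α) [DecidableRel G.Adj] (A : W → Finset α) {d θ b : ℝ}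
    (hd : 0 < d) (hd1 : d ≤ 1) (hθ : 0 ≤ θ) (hb : 2 ≤ b)
    (hA : ∀ v w, H.Adj v w → ∀ Y ⊆ A w, θ ≤ #Y →
      (#{x ∈ A v | (#{y ∈ Y | G.Adj x y} : ℝ) < d * #Y} : ℝ) ≤ θ)
    (S : Finset W) (C : W → Finset α) (hC : ∀ w ∈ S, C w ⊆ A w) (hS : #S * θ < b)
    (hcard : ∀ w ∈ S, b ≤ (d / 2) ^ #S * #(C w)) :
    ∃ f : W → α, (∀ w ∈ S, f w ∈ C w) ∧ Set.InjOn f S ∧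
      ∀ v ∈ S, ∀ w ∈ S, H.Adj v w → G.Adj (f v) (f w) := by
  classical
  induction S using Finset.induction_on generalizing C with
  | empty => exact ⟨fun _ => Classical.arbitrary α, by simp⟩
  | insert v S hv ih =>
    rw [card_insert_of_notMem hv] at hS hcard
    push_cast at hS
    have hC_card : ∀ w ∈ insert v S, b ≤ #(C w) := fun w hw =>
      (hcard w hw).trans (mul_le_of_le_one_left (Nat.cast_nonneg _)
        (pow_le_one₀ (by linarith) (by linarith)))
    have hSθ : (0 : ℝ) ≤ #S * θ := by positivity
    -- All but at most `#S * θ` candidates for `v` have many neighbours in each `C w`.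
    let bad (w : W) : Finset α :=
      {x ∈ A v | (#{y ∈ C w | G.Adj x y} : ℝ) < d * #(C w)}
    obtain ⟨x, hxC, hx⟩ : ∃ x ∈ C v, x ∉ {w ∈ S | H.Adj v w}.biUnion bad := by
      refine exists_mem_notMem_of_card_lt_card ?_
      have h1 : (#({w ∈ S | H.Adj v w}.biUnion bad) : ℝ) ≤ #S * θ := by
        calc (#({w ∈ S | H.Adj v w}.biUnion bad) : ℝ)
            ≤ ∑ w ∈ S with H.Adj v w, (#(bad w) : ℝ) := mod_cast card_biUnion_le
          _ ≤ ∑ w ∈ S with H.Adj v w, θ := by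
              refine sum_le_sum fun w hw => ?_
              rw [mem_filter] at hw
              have hw' := mem_insert_of_mem (a := w) (b := v) hw.1
              exact hA v w hw.2 _ (hC w hw') (by linarith [hC_card w hw'])
          _ ≤ ∑ w ∈ S, θ := sum_le_sum_of_subset_of_nonneg (filter_subset _ _) fun _ _ _ => hθ
          _ = #S * θ := by simp
      have h2 := hC_card v (mem_insert_self _ _)
      exact_mod_cast (show (#({w ∈ S | H.Adj v w}.biUnion bad) : ℝ) < #(C v) by linarith)
    -- Removing `x` from all candidate sets makes the embedding injective.
    let C' (w : W) : Finset α := {y ∈ C w | y ≠ x ∧ (H.Adj v w → G.Adj x y)}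
    have hC' : ∀ w ∈ S, d / 2 * #(C w) ≤ #(C' w) := by
      intro w hw
      have hw' : b ≤ #(C w) := hC_card w (mem_insert_of_mem hw)
      by_cases hvw : H.Adj v w
      · have h1 : C' w = {y ∈ C w | G.Adj x y} := by
          ext y
          simp only [C', mem_filter, hvw, true_imp_iff]
          exact and_congr_right fun _ => ⟨fun h => h.2, fun h => ⟨h.ne', h⟩⟩
        have h2 : x ∉ bad w := fun h =>
          hx (mem_biUnion.2 ⟨w, mem_filter.2 ⟨hw, hvw⟩, h⟩)
        have h3 : d * #(C w) ≤ #(C' w) := by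
          rw [h1]
          by_contra! h
          exact h2 (mem_filter.2 ⟨hC v (mem_insert_self _ _) hxC, h⟩)
        nlinarith
      · have h1 : C' w = (C w).erase x := by
          ext y
          simp [C', hvw, and_comm]
        have h2 : (#(C w) : ℝ) ≤ #(C' w) + 1 := by
          rw [h1]
          have h3 := pred_card_le_card_erase (s := C w) (a := x)
          exact_mod_cast (show #(C w) ≤ #((C w).erase x) + 1 by omega)
        nlinarith
    obtain ⟨f, hf, hinj, hadj⟩ := ih C' (fun w hw => (filter_subset _ _).trans
      (hC w (mem_insert_of_mem hw))) (by linarith) (fun w hw => by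
        refine (hcard w (mem_insert_of_mem hw)).trans ?_
        rw [pow_succ, mul_assoc]
        exact mul_le_mul_of_nonneg_left (hC' w hw) (by positivity))
    have hne : ∀ w ∈ S, w ≠ v := fun w hw h => hv (h ▸ hw)
    have hfx : ∀ w ∈ S, f w ∈ C w ∧ f w ≠ x ∧ (H.Adj v w → G.Adj x (f w)) := fun w hw =>
      mem_filter.1 (hf w hw)
    refine ⟨Function.update f v x, ?_, ?_, ?_⟩
    · intro w hw
      obtain rfl | hw := mem_insert.1 hw
      · simpa using hxC
      · simpa [hne w hw] using (hfx w hw).1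
    · intro w hw w' hw' h
      rw [mem_coe, mem_insert] at hw hw'
      obtain rfl | hw := hw <;> obtain rfl | hw' := hw'
      · rfl
      · simp only [Function.update_self, Function.update_of_ne (hne w' hw')] at h
        exact ((hfx w' hw').2.1 h.symm).elim
      · simp only [Function.update_self, Function.update_of_ne (hne w hw)] at h
        exact ((hfx w hw).2.1 h).elim
      · simp only [Function.update_of_ne (hne w hw), Function.update_of_ne (hne w' hw')] at h
        exact hinj hw hw' h
    · intro w hw w' hw' h
      rw [mem_insert] at hw hw'
      obtain rfl | hw := hw <;> obtain rfl | hw' := hw'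
      · exact (H.irrefl h).elim
      · simpa [hne w' hw'] using (hfx w' hw').2.2 h
      · simpa [hne w hw] using ((hfx w hw).2.2 h.symm).symm
      · simpa [hne w hw, hne w' hw'] using hadj w hw w' hw' h

/-- In a uniform pair, few vertices of one side have few neighbours in a large subset of the
other. -/
lemma IsUniform.card_filter_le {α : Type*} {G : SimpleGraph α} [DecidableRel G.Adj]
    {U V Y : Finset α} {η δ θ : ℝ} (h : G.IsUniform η U V) (hδ : δ ≤ G.edgeDensity U V)
    (hηδ : η ≤ δ / 2) (hU : #U * η ≤ θ) (hV : #V * η ≤ θ) (hYV : Y ⊆ V) (hY : θ ≤ #Y) :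
    (#{x ∈ U | (#{y ∈ Y | G.Adj x y} : ℝ) < δ / 2 * #Y} : ℝ) ≤ θ := by
  classical
  set X : Finset α := {x ∈ U | (#{y ∈ Y | G.Adj x y} : ℝ) < δ / 2 * #Y} with hX
  by_contra! hlt
  have hη := h.pos
  have hθ : 0 ≤ θ := le_trans (by positivity) hU
  have hden := h (filter_subset _ _ : X ⊆ U) hYV (hU.trans hlt.le) (hV.trans hY)
  have hden' : δ / 2 < G.edgeDensity X Y := by
    have := (abs_lt.1 hden).1
    linarith
  have hinter : (#(G.interedges X Y) : ℝ) ≤ δ / 2 * (#X * #Y) := by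
    have : #(G.interedges X Y) = ∑ x ∈ X, #{y ∈ Y | G.Adj x y} := by
      rw [interedges_def, card_filter, sum_product]
      exact sum_congr rfl fun x _ => (card_filter _ _).symm
    rw [this]
    push_cast
    calc ∑ x ∈ X, (#{y ∈ Y | G.Adj x y} : ℝ) ≤ ∑ x ∈ X, δ / 2 * #Y :=
          sum_le_sum fun x hx => (mem_filter.1 hx).2.le
      _ = δ / 2 * (#X * #Y) := by simp; ring
  rw [edgeDensity_def] at hden'
  push_cast at hden'
  exact absurd (div_le_of_le_mul₀ (by positivity) (by linarith) hinter) (not_le.2 hden')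

/-- A homomorphism to the reduced graph of an equipartition into large parts yields a copy in the
original graph. -/
lemma isContained_of_hom_regularityReduced {W α : Type*} [Fintype W] [Fintype α] [DecidableEq α]
    {H : SimpleGraph W} {G : SimpleGraph α} [DecidableRel G.Adj]
    {P : Finpartition (univ : Finset α)} (hP : P.IsEquipartition) {m : ℕ} {η δ : ℝ}
    (hm : Fintype.card W ≤ m) (hη : 0 < η) (hδ : 0 < δ) (hδ1 : δ ≤ 1) (hηδ : η ≤ δ / 2)
    (hηm : 2 * m * η < (δ / 4) ^ m)
    (hsize : 2 ≤ (δ / 4) ^ m * (Fintype.card α / #P.parts : ℕ))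
    (φ : H →g G.regularityReduced P η δ) : H ⊑ G := by
  set s : ℕ := Fintype.card α / #P.parts with hs
  have hκ : (δ / 4) ^ m ≤ 1 := pow_le_one₀ (by linarith) (by linarith)
  have hs2 : (2 : ℝ) ≤ s := hsize.trans (mul_le_of_le_one_left (Nat.cast_nonneg _) hκ)
  have hα : Nonempty α := by
    by_contra! h
    simp [hs] at hs2
    linarith
  have hlow : ∀ U ∈ P.parts, (s : ℝ) ≤ #U := fun U hU => by
    have := hP.average_le_card_part hU
    rw [card_univ] at this
    exact_mod_cast this
  have hup : ∀ U ∈ P.parts, #U * η ≤ 2 * s * η := fun U hU => by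
    have h1 := hP.card_part_le_average_add_one hU
    rw [card_univ] at h1
    have h2 : (#U : ℝ) ≤ s + 1 := by exact_mod_cast h1
    gcongr
    linarith
  let A (w : W) : Finset α := P.part (φ w)
  have hmem (w : W) : A w ∈ P.parts := P.part_mem.2 (mem_univ _)
  obtain ⟨f, -, hinj, hadj⟩ := exists_greedy_embedding H G A (d := δ / 2) (θ := 2 * s * η)
    (b := (δ / 4) ^ m * s) (by linarith) (by linarith) (by positivity) hsize
    (by
      intro v w hvw Y hY hYcard
      obtain ⟨-, U, hU, V, hV, hvU, hwV, -, huni, hden⟩ := φ.map_adj hvw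
      have hAU : A v = U := P.part_eq_of_mem hU hvU
      have hAV : A w = V := P.part_eq_of_mem hV hwV
      rw [hAU]
      exact huni.card_filter_le hden hηδ (hup U hU) (hup V hV) (hAV ▸ hY) hYcard)
    univ A (fun _ _ => Subset.rfl)
    (by
      rw [card_univ]
      have h1 : (Fintype.card W : ℝ) ≤ m := by exact_mod_cast hm
      calc (Fintype.card W : ℝ) * (2 * s * η) ≤ m * (2 * s * η) := by gcongr
        _ = 2 * m * η * s := by ring
        _ < (δ / 4) ^ m * s := by gcongr)
    (by
      intro w _
      rw [card_univ, div_div, show (2 : ℝ) * 2 = 4 by norm_num]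
      exact mul_le_mul (pow_le_pow_of_le_one (by linarith) (by linarith) hm) (hlow _ (hmem w))
        (by positivity) (by positivity))
  exact ⟨⟨⟨f, fun h => hadj _ (mem_univ _) _ (mem_univ _) h⟩,
    fun a b h => hinj (by simp) (by simp) h⟩⟩

/-! ### The removal statement for homomorphisms -/

/-- Passing to the reduced graph of a uniform equipartition into many parts loses few edges. -/
lemma card_edgeFinset_sub_regularityReduced_lt {α : Type*} [Fintype α] [DecidableEq α] [Nonempty α]
    {G : SimpleGraph α} [DecidableRel G.Adj] {P : Finpartition (univ : Finset α)}
    {ε η : ℝ} (hε : 0 < ε) (hη : 0 < η) (hηε : η ≤ ε / 8) (hP : P.IsEquipartition)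
    (hPη : P.IsUniform G η) (hP' : 4 / ε ≤ #P.parts) :
    (#G.edgeFinset - #(G.regularityReduced P η (ε / 4)).edgeFinset : ℝ)
      < ε * (Fintype.card α : ℝ) ^ 2 := by
  let A := (P.nonUniforms G η).biUnion fun (U, V) ↦ U ×ˢ V
  let B := P.parts.biUnion offDiag
  let C := (P.sparsePairs G (ε / 4)).biUnion fun (U, V) ↦ G.interedges U V
  have hsub : (univ ×ˢ univ).filter (fun (x, y) ↦
      G.Adj x y ∧ ¬(G.regularityReduced P η (ε / 4)).Adj x y) ⊆ A ∪ B ∪ C := by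
    rintro ⟨x, y⟩ hxy
    simp only [mem_filter, mem_product, mem_univ, true_and] at hxy
    obtain ⟨hadj, hred⟩ := hxy
    have hU : P.part x ∈ P.parts := P.part_mem.2 (mem_univ _)
    have hV : P.part y ∈ P.parts := P.part_mem.2 (mem_univ _)
    have hx : x ∈ P.part x := P.mem_part (mem_univ _)
    have hy : y ∈ P.part y := P.mem_part (mem_univ _)
    by_cases hUV : P.part x = P.part y
    · exact mem_union_left _ (mem_union_right _ (mem_biUnion.2
        ⟨P.part x, hU, mem_offDiag.2 ⟨hx, hUV ▸ hy, hadj.ne⟩⟩))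
    by_cases huni : G.IsUniform η (P.part x) (P.part y)
    · refine mem_union_right _ (mem_biUnion.2 ⟨(P.part x, P.part y), ?_, ?_⟩)
      · rw [Finpartition.mk_mem_sparsePairs]
        refine ⟨hU, hV, hUV, ?_⟩
        by_contra! hden
        exact hred ⟨hadj, _, hU, _, hV, hx, hy, hUV, huni, hden⟩
      · exact G.mk_mem_interedges_iff.2 ⟨hx, hy, hadj⟩
    · exact mem_union_left _ (mem_union_left _ (mem_biUnion.2 ⟨(P.part x, P.part y),
        (Finpartition.mk_mem_nonUniforms ..).2 ⟨hU, hV, hUV, huni⟩, mem_product.2 ⟨hx, hy⟩⟩))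
  have hA : (#A : ℝ) < 4 * η * (Fintype.card α : ℝ) ^ 2 :=
    hP.sum_nonUniforms_lt univ_nonempty hη hPη
  have hB : (#B : ℝ) ≤ ε / 2 * (Fintype.card α : ℝ) ^ 2 :=
    hP.card_biUnion_offDiag_le hε hP'
  have hC : (#C : ℝ) ≤ 4 * (ε / 4) * (Fintype.card α : ℝ) ^ 2 :=
    hP.card_interedges_sparsePairs_le (G := G) (ε := ε / 4) (by positivity)
  have hABC : (#(A ∪ B ∪ C) : ℝ) ≤ #A + #B + #C := by
    exact_mod_cast (card_union_le _ _).trans (Nat.add_le_add_right (card_union_le _ _) _)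
  have htwice : 2 * (#G.edgeFinset - #(G.regularityReduced P η (ε / 4)).edgeFinset : ℝ) =
      (#((univ ×ˢ univ).filter fun (x, y) ↦
          G.Adj x y ∧ ¬(G.regularityReduced P η (ε / 4)).Adj x y) : ℝ) := by
    rw [univ_product_univ, mul_sub, filter_and_not, cast_card_sdiff]
    · norm_cast
      rw [two_mul_card_edgeFinset, two_mul_card_edgeFinset]
    · gcongr with xy _
      exact fun hxy ↦ regularityReduced_le hxy
  have hle : (#((univ ×ˢ univ).filter fun (x, y) ↦
      G.Adj x y ∧ ¬(G.regularityReduced P η (ε / 4)).Adj x y) : ℝ) ≤ #(A ∪ B ∪ C) := by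
    exact_mod_cast card_le_card hsub
  have hmul : η * (Fintype.card α : ℝ) ^ 2 ≤ ε / 8 * (Fintype.card α : ℝ) ^ 2 := by gcongr
  linarith

open scoped Classical in
/-- Removal for homomorphisms: few edges of a large graph `G` can be deleted so that every graph of
bounded order with a homomorphism to what remains is contained in `G`. -/
theorem exists_le_forall_hom_isContained (m : ℕ) {ε : ℝ} (hε : 0 < ε) :
    ∃ N : ℕ, ∀ n ≥ N, ∀ G : SimpleGraph (Fin n), ∃ G' ≤ G,
      (#G.edgeFinset - #G'.edgeFinset : ℝ) ≤ ε * (n : ℝ) ^ 2 ∧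
      ∀ (W : Type u) [Finite W] (H : SimpleGraph W), Nat.card W ≤ m →
        Nonempty (H →g G') → H ⊑ G := by
  wlog hε1 : ε ≤ 1 generalizing ε
  · obtain ⟨N, hN⟩ := this one_pos le_rfl
    refine ⟨N, fun n hn G => ?_⟩
    obtain ⟨G', hle, hcard, hhom⟩ := hN n hn G
    refine ⟨G', hle, hcard.trans ?_, hhom⟩
    gcongr
    exact (not_le.1 hε1).le
  set κ : ℝ := (ε / 4 / 4) ^ m with hκ
  have hκ0 : 0 < κ := by positivity
  -- The first bound controls the number of lost edges, the second the greedy embedding.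
  set η : ℝ := min (ε / 8) (κ / (4 * (m + 1))) with hη
  have hη0 : 0 < η := by positivity
  have hηε : η ≤ ε / 8 := min_le_left _ _
  have hηm : 2 * m * η < κ := by
    have h1 : η ≤ κ / (4 * (m + 1)) := min_le_right _ _
    rw [le_div_iff₀ (by positivity)] at h1
    nlinarith [mul_nonneg (Nat.cast_nonneg (α := ℝ) m) hη0.le]
  set l : ℕ := ⌈4 / ε⌉₊ with hl
  set M : ℕ := SzemerediRegularity.bound η l with hM
  -- For such `n` every part has at least `2 / κ` vertices.
  refine ⟨max (max l 1) (⌈2 / κ⌉₊ * M), fun n hn G => ?_⟩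
  have hln : l ≤ n := ((le_max_left _ _).trans (le_max_left _ _)).trans hn
  have h1n : 1 ≤ n := ((le_max_right _ _).trans (le_max_left _ _)).trans hn
  have hMn : ⌈2 / κ⌉₊ * M ≤ n := (le_max_right _ _).trans hn
  have : Nonempty (Fin n) := ⟨⟨0, h1n⟩⟩
  obtain ⟨P, hP, hlP, hPM, hPη⟩ := szemeredi_regularity G hη0 (l := l) (by simpa using hln)
  have hP' : 4 / ε ≤ #P.parts := (Nat.le_ceil _).trans (by exact_mod_cast hlP)
  refine ⟨G.regularityReduced P η (ε / 4), regularityReduced_le, ?_, ?_⟩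
  · have := card_edgeFinset_sub_regularityReduced_lt hε hη0 hηε hP hPη hP'
    rw [Fintype.card_fin] at this
    refine le_trans (le_of_eq ?_) this.le
    congr!
  · rintro W _ H hW ⟨φ⟩
    have := Fintype.ofFinite W
    refine isContained_of_hom_regularityReduced hP (by rwa [← Nat.card_eq_fintype_card]) hη0
      (by linarith) (by linarith) (by linarith) hηm ?_ φ
    have hpos : 0 < #P.parts := (P.parts_nonempty (univ_nonempty.ne_empty)).card_pos
    have h1 : ⌈2 / κ⌉₊ ≤ n / #P.parts :=
      (Nat.le_div_iff_mul_le hpos).2 ((Nat.mul_le_mul_left _ hPM).trans hMn)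
    have h2 : 2 / κ ≤ (n / #P.parts : ℕ) := (Nat.le_ceil _).trans (by exact_mod_cast h1)
    rw [Fintype.card_fin]
    rwa [div_le_iff₀' hκ0] at h2

/-! ### Deleting edges to reach a `k`-colorable graph -/

open scoped Classical in
/-- Deleting the edges of `G` outside `G'` and then an optimal set of edges of `G'` leaves a
`k`-colorable graph. -/
lemma colorDeletion_le_add {V : Type*} [Fintype V] {G G' : SimpleGraph V} (h : G' ≤ G) {k : ℕ}
    (hk : 0 < k) :
    (G.colorDeletion k : ℝ) ≤ G'.colorDeletion k + (#G.edgeFinset - #G'.edgeFinset) := by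
  have hne : {m : ℕ | ∃ s : Finset (Sym2 V), (s : Set (Sym2 V)) ⊆ G'.edgeSet ∧ #s = m ∧
      (G'.deleteEdges (s : Set (Sym2 V))).Colorable k}.Nonempty := by
    refine ⟨_, G'.edgeFinset, by simp, rfl, ?_⟩
    rw [deleteEdges_eq_bot.2 (by simp)]
    exact ⟨Coloring.mk (fun _ => ⟨0, hk⟩) (fun h => h.elim)⟩
  obtain ⟨s, hs, hcard, hcol⟩ := Nat.sInf_mem hne
  have hE : G'.edgeFinset ⊆ G.edgeFinset := edgeFinset_mono h
  have hle : G.colorDeletion k ≤ #(s ∪ (G.edgeFinset \ G'.edgeFinset)) := by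
    refine Nat.sInf_le ⟨_, ?_, rfl, ?_⟩
    · intro e he
      simp only [coe_union, coe_sdiff, coe_edgeFinset] at he
      exact he.elim (fun he => edgeSet_mono h (hs he)) (fun he => he.1)
    · refine hcol.mono_left ?_
      intro v w hvw
      simp only [deleteEdges_adj, coe_union, coe_sdiff, coe_edgeFinset, Set.mem_union,
        Set.mem_sdiff, mem_edgeSet, not_or, not_and, not_not] at hvw ⊢
      exact ⟨hvw.2.2 hvw.1, hvw.2.1⟩
  have h1 : (#(s ∪ (G.edgeFinset \ G'.edgeFinset)) : ℝ) ≤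
      #s + (#G.edgeFinset - #G'.edgeFinset) := by
    rw [← cast_card_sdiff hE]
    exact_mod_cast card_union_le _ _
  have h2 : (#s : ℝ) = G'.colorDeletion k := by rw [hcard]; rfl
  rw [← h2]
  exact le_trans (by exact_mod_cast hle) h1

lemma maxColorDeletionFamily_const (n k : ℕ) {W : Type*} (H : SimpleGraph W) :
    maxColorDeletionFamily n k (fun _ : Unit => H) = maxColorDeletion n k H := by
  unfold maxColorDeletionFamily maxColorDeletion
  congr! 2
  simp [FamilyFree]

lemma maxColorDeletion_mono (n k : ℕ) {W W' : Type*} {H : SimpleGraph W} {H' : SimpleGraph W'}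
    (h : H' ⊑ H) : maxColorDeletion n k H' ≤ maxColorDeletion n k H := by
  classical
  exact sup_mono (monotone_filter_right _ fun _ _ hG hc => hG (h.trans hc))

/-- The error term may be taken to be the positive part of the difference of the two maxima; the
removal statement makes it eventually at most `ε n²` for each `ε > 0`. -/
lemma exists_isLittleO_maxColorDeletionFamily {ι ι' : Type*} [Finite ι]
    {W : ι → Type*} {W' : ι' → Type*} [∀ i, Finite (W i)]
    (F : ∀ i, SimpleGraph (W i)) (F' : ∀ j, SimpleGraph (W' j)) {k : ℕ} (hk : 0 < k)
    (h : ∀ j, ∃ i, Nonempty (F i →g F' j)) :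
    ∃ f : ℕ → ℝ, f =o[atTop] (fun n : ℕ => (n : ℝ) ^ 2) ∧
      ∀ n : ℕ, (maxColorDeletionFamily n k F : ℝ) ≤ maxColorDeletionFamily n k F' + f n := by
  classical
  refine ⟨fun n => max ((maxColorDeletionFamily n k F : ℝ) - maxColorDeletionFamily n k F') 0,
    ?_, fun n => sub_le_iff_le_add'.1 (le_max_left _ _)⟩
  rw [Asymptotics.isLittleO_iff]
  intro ε hε
  obtain ⟨m, hm⟩ := Set.finite_range (fun i => Nat.card (W i)) |>.bddAbove
  obtain ⟨N, hN⟩ := exists_le_forall_hom_isContained m hε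
  filter_upwards [eventually_ge_atTop N] with n hn
  rw [Real.norm_of_nonneg (le_max_right _ _), Real.norm_of_nonneg (by positivity)]
  refine max_le ?_ (by positivity)
  rw [sub_le_iff_le_add']
  -- The maximum over no graphs is `0`, so a graph attaining it is only available if it is positive.
  obtain h0 | h0 := (maxColorDeletionFamily n k F).eq_zero_or_pos
  · rw [h0, Nat.cast_zero]
    positivity
  obtain ⟨G, hG, hGk⟩ := exists_mem_eq_sup
    (univ.filter fun G : SimpleGraph (Fin n) => FamilyFree F G)
    (nonempty_of_ne_empty fun he => h0.ne' (by
      simp only [maxColorDeletionFamily, he, sup_empty, bot_eq_zero]))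
    (fun G : SimpleGraph (Fin n) => G.colorDeletion k)
  obtain ⟨G', hle, hcard, hhom⟩ := hN n hn G
  have hfree : FamilyFree F' G' := by
    rintro j ⟨c⟩
    obtain ⟨i, ⟨φ⟩⟩ := h j
    exact (mem_filter.1 hG).2 i (hhom _ _ (hm ⟨i, rfl⟩) ⟨c.toHom.comp φ⟩)
  have h1 : G'.colorDeletion k ≤ maxColorDeletionFamily n k F' := by
    classical
    exact le_sup (f := fun G : SimpleGraph (Fin n) => G.colorDeletion k)
      (mem_filter.2 ⟨mem_univ _, hfree⟩)
  have h2 : (G'.colorDeletion k : ℝ) ≤ maxColorDeletionFamily n k F' := by exact_mod_cast h1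
  have h3 := colorDeletion_le_add hle hk
  have h4 : maxColorDeletionFamily n k F = G.colorDeletion k := by
    rw [← hGk]
    unfold maxColorDeletionFamily
    congr!
  rw [h4]
  linarith

end SimpleGraph

theorem theoremc (k : ℕ) (hk : 0 < k) :
    (∀ (W : Type*) [Finite W] (H : SimpleGraph W) (H' : H.Subgraph),
      Nonempty (H →g H'.coe) →
        (∀ n : ℕ, SimpleGraph.maxColorDeletion n k H'.coe ≤ SimpleGraph.maxColorDeletion n k H) ∧
        ∃ f : ℕ → ℝ, f =o[Filter.atTop] (fun n : ℕ => (n : ℝ) ^ 2) ∧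
          ∀ n : ℕ, (SimpleGraph.maxColorDeletion n k H : ℝ) ≤
            (SimpleGraph.maxColorDeletion n k H'.coe : ℝ) + f n) ∧
    (∀ (ι ι' : Type*) [Finite ι] [Finite ι'] (W : ι → Type*) (W' : ι' → Type*)
      [∀ i, Finite (W i)] [∀ j, Finite (W' j)]
      (F : ∀ i, SimpleGraph (W i)) (F' : ∀ j, SimpleGraph (W' j)),
      (∀ j, ∃ i, Nonempty (F i →g F' j)) →
        ∃ f : ℕ → ℝ, f =o[Filter.atTop] (fun n : ℕ => (n : ℝ) ^ 2) ∧
          ∀ n : ℕ, (SimpleGraph.maxColorDeletionFamily n k F : ℝ) ≤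
            (SimpleGraph.maxColorDeletionFamily n k F' : ℝ) + f n) := by
  refine ⟨fun W _ H H' hφ => ⟨fun n => SimpleGraph.maxColorDeletion_mono n k H'.coe_isContained, ?_⟩,
    fun ι ι' _ _ W W' _ _ F F' h =>
      SimpleGraph.exists_isLittleO_maxColorDeletionFamily F F' hk h⟩
  obtain ⟨f, hf, hle⟩ := SimpleGraph.exists_isLittleO_maxColorDeletionFamily
    (fun _ : Unit => H) (fun _ : Unit => H'.coe) hk (fun _ => ⟨(), hφ⟩)
  simp only [SimpleGraph.maxColorDeletionFamily_const] at hle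
  exact ⟨f, hf, hle⟩
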